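/- Let $n\ge 1$ be an integer, let $F$ be a finitely generated non-cyclic free group, and let $F_1,\dots,F_k\leqslant F$ be a (possibly empty) finite collection of finitely generated subgroups of infinite index in $F$. Then there exists a subgroup $H\leqslant F$ that is free of rank $n$, malnormal in $F$ (that is, $H\cap H^g=1$ for all $g\in F\setminus H$), and satisfies $F_i\cap H^g=1$ for all $i\in\{1,\dots,k\}$ and all $g\in F$. Here $H^g=g^{-1}Hg$. -/

import Mathlib

/-- The conjugate `g⁻¹ H g` of a subgroup `H` by an element `g`. -/
def conjSubgroup {G : Type*} [Group G] (H : Subgroup G) (g : G) : Subgroup G :=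
  H.map (MulAut.conj g⁻¹).toMonoidHom

theorem mem_conjSubgroup {G : Type*} [Group G] (H : Subgroup G) (g x : G) :
    x ∈ conjSubgroup H g ↔ ∃ h ∈ H, g⁻¹ * h * g = x := by
  simp [conjSubgroup, Subgroup.mem_map]

/-- A subgroup `H` is malnormal if it meets each of its conjugates by an element outside `H`
trivially. -/
def IsMalnormal {G : Type*} [Group G] (H : Subgroup G) : Prop :=
  ∀ g : G, g ∉ H → H ⊓ conjSubgroup H g = ⊥

/-- A group is free of rank `n` if it has a free basis with exactly `n` elements. -/
def IsFreeOfRank (G : Type*) [Group G] (n : ℕ) : Prop :=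
  Nonempty (FreeGroupBasis (Fin n) G)

/-! Two facts about reduced words carry the proof.

Avoidance. Reading the reduced words of a finitely generated subgroup `L` visits only finitely many
cosets of `L`. If the index is infinite, some positive word `u` leaves this finite set from every
starting point in it, so `u` occurs in no reduced word of an element of `L`. Positive words
concatenate without cancellation, so one `u` serves all the given subgroups.

Rigidity. Let `H` be generated by the words `t_i · b u · b a^(N_i) b · t_i`, where `t_i = a^i
b^(n-i)` and the `N_i` are distinct and large. In a product, cancellation stays within the tails
`t_i`, so every core `b u b a^(N_i) b` survives and `H` is free on these words. The runs are too
long for a marker `b a^(N_i) b` to occur by accident, so the place where a core occurs in a word of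
`H` is determined modulo `H`.

For `h ≠ 1` in `H` and any `g`, the reduced word of some power of `g h g⁻¹` contains a core. If `g h
g⁻¹` lies in `H`, comparing the two descriptions of the prefix before this core gives `g ∈ H`, which
is malnormality (`isMalnormal_range_subst`). Since a core contains `u` or its inverse, no nontrivial
conjugate lies in a given subgroup (`inf_conjSubgroup_range_subst`). -/

namespace FreeGroup

variable {X : Type*}

/-! ### Positive words avoided by subgroups of infinite index -/

theorem prefix_append_cases {γ : Type*} {p a b : List γ} (h : p <+: a ++ b) :
    p <+: a ∨ ∃ r, p = a ++ r ∧ r <+: b := by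
  obtain ⟨t, ht⟩ := h
  rcases List.append_eq_append_iff.1 ht with ⟨c, rfl, rfl⟩ | ⟨c, rfl, rfl⟩
  · exact .inl ⟨c, rfl⟩
  · exact .inr ⟨c, rfl, t, rfl⟩

/-- Every element represented by a prefix of a reduction of a word is represented by a prefix of
the word itself. -/
theorem Red.exists_prefix {l l' : List (X × Bool)} (h : Red l l') {p : List (X × Bool)}
    (hp : p <+: l') : ∃ p', p' <+: l ∧ mk p' = mk p := by
  induction h generalizing p with
  | refl => exact ⟨p, hp, rfl⟩
  | tail _ hs ih =>
    cases hs with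
    | @not L₁ L₂ x b =>
      rcases prefix_append_cases hp with h | ⟨r, rfl, hr⟩
      · exact ih (h.trans (List.prefix_append _ _))
      · obtain ⟨p', hp', e⟩ := ih (p := L₁ ++ (x, b) :: (x, !b) :: r) (by
          simpa [List.prefix_append_right_inj] using hr)
        refine ⟨p', hp', e.trans (Quot.sound Red.Step.not)⟩

variable [DecidableEq X]

theorem exists_prefix_toWord_mul {g h : FreeGroup X} {p : List (X × Bool)}
    (hp : p <+: (g * h).toWord) :
    (∃ p', p' <+: g.toWord ∧ mk p' = mk p) ∨ ∃ p', p' <+: h.toWord ∧ g * mk p' = mk p := by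
  rw [toWord_mul] at hp
  obtain ⟨p', hp', e⟩ := Red.exists_prefix reduce.red hp
  rcases prefix_append_cases hp' with h | ⟨r, rfl, hr⟩
  · exact .inl ⟨p', h, e⟩
  · refine .inr ⟨r, hr, ?_⟩
    rw [← e, ← mul_mk, mk_toWord]

/-- The cosets visited by the reduced words of the elements of a finitely generated subgroup. -/
theorem exists_finite_cosets_of_fg {L : Subgroup (FreeGroup X)} (hL : L.FG) :
    ∃ V : Set (FreeGroup X ⧸ L), V.Finite ∧
      ∀ h ∈ L, ∀ p, p <+: h.toWord → (((mk p)⁻¹ : FreeGroup X) : FreeGroup X ⧸ L) ∈ V := by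
  obtain ⟨S, rfl⟩ := hL
  set L := Subgroup.closure (S : Set (FreeGroup X))
  let f : List (X × Bool) → FreeGroup X ⧸ L := fun p => (((mk p)⁻¹ : FreeGroup X) : FreeGroup X ⧸ L)
  -- Inverses turn right cosets into left ones: left multiplication of `x` by an element of `L` does
  -- not move the coset of `x⁻¹`.
  have key : ∀ (g : FreeGroup X), g ∈ L → ∀ x y : FreeGroup X, g * x = y →
      ((x⁻¹ : FreeGroup X) : FreeGroup X ⧸ L) = ((y⁻¹ : FreeGroup X) : FreeGroup X ⧸ L) := by
    rintro g hg x y rfl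
    rw [QuotientGroup.eq]
    simpa using hg
  refine ⟨insert ((1 : FreeGroup X) : FreeGroup X ⧸ L)
    (⋃ s ∈ S, f '' {p | p ∈ s.toWord.inits}), ?_, ?_⟩
  · refine Set.Finite.insert _ (Set.Finite.biUnion S.finite_toSet fun s _ => Set.Finite.image _ ?_)
    exact List.finite_toSet _
  · intro h hh
    induction hh using Subgroup.closure_induction with
    | mem s hs =>
      intro p hp
      refine Set.mem_insert_of_mem _ (Set.mem_biUnion hs ⟨p, by simpa using hp, rfl⟩)
    | one =>
      intro p hp
      simp only [toWord_one, List.prefix_nil] at hp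
      subst hp
      left; rfl
    | mul x y hx hy ihx ihy =>
      intro p hp
      rcases exists_prefix_toWord_mul hp with ⟨p', hp', e⟩ | ⟨p', hp', e⟩
      · rw [← e]; exact ihx _ hp'
      · rw [← key x hx _ _ e]; exact ihy _ hp'
    | inv x hx ih =>
      intro p hp
      obtain ⟨r, hr⟩ := hp
      have h1 : x = mk (invRev r) * (mk p)⁻¹ := by
        rw [← mk_toWord (x := x), ← invRev_invRev (L₁ := x.toWord), ← toWord_inv, ← hr, invRev_append,
          ← mul_mk, inv_mk]
      have h2 : invRev r <+: x.toWord :=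
        ⟨invRev p, by rw [← invRev_append, hr, toWord_inv, invRev_invRev]⟩
      have := ih _ h2
      rwa [key x⁻¹ (inv_mem hx) (mk (invRev r)) (mk p) (by rw [h1]; group)] at this

/-- A word is positive if it does not involve inverses of generators. -/
def IsPositive {X : Type*} (l : List (X × Bool)) : Prop := ∀ z ∈ l, z.2 = true

open Pointwise in
/-- A finite set of cosets of a subgroup of infinite index is left by a positive word, from any
given starting point. -/
theorem exists_isPositive_smul_notMem {X : Type*} {L : Subgroup (FreeGroup X)}
    (hL : ¬ L.FiniteIndex) {V : Set (FreeGroup X ⧸ L)} (hV : V.Finite) (v : FreeGroup X ⧸ L) :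
    ∃ w : List (X × Bool), IsPositive w ∧ (mk w)⁻¹ • v ∉ V := by
  by_contra! hc
  let W : Set (FreeGroup X ⧸ L) := {q | ∃ w : List (X × Bool), IsPositive w ∧ (mk w)⁻¹ • v = q}
  have hWf : W.Finite := hV.subset (by rintro _ ⟨w, hw, rfl⟩; exact hc w hw)
  have hst : MulAction.stabilizer (FreeGroup X) W = ⊤ := by
    rw [eq_top_iff, ← closure_range_of, Subgroup.closure_le]
    rintro _ ⟨x, rfl⟩
    rw [SetLike.mem_coe, ← inv_mem_iff, MulAction.mem_stabilizer_iff]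
    -- The inverse of a generator maps the finite set `W` into itself, hence onto itself; so
    -- positive words already give invariance under the whole group.
    apply Set.eq_of_subset_of_ncard_le _ _ hWf
    · rintro _ ⟨_, ⟨w, hw, rfl⟩, rfl⟩
      refine ⟨w ++ [(x, true)], ?_, ?_⟩
      · intro z hz
        rcases List.mem_append.1 hz with h | h
        · exact hw z h
        · simp_all
      · rw [← mul_mk, mul_inv_rev, mul_smul]; rfl
    · rw [Set.ncard_smul_set]
  have hW : W = Set.univ := by
    refine Set.eq_univ_of_forall fun q => ?_
    obtain ⟨g, rfl⟩ := MulAction.exists_smul_eq (FreeGroup X) v q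
    have hg : g ∈ MulAction.stabilizer (FreeGroup X) W := hst ▸ Subgroup.mem_top g
    rw [← MulAction.mem_stabilizer_iff.1 hg]
    exact Set.smul_mem_smul_set ⟨[], by simp [IsPositive], by simp [← one_eq_mk]⟩
  have : Finite (FreeGroup X ⧸ L) := Set.finite_univ_iff.1 (hW ▸ hWf)
  exact hL Subgroup.finiteIndex_of_finite_quotient

/-- The starting points are treated one at a time: a word that works for `S` moves a new point `v`
somewhere, and appending an exit word from there keeps the earlier exits, since they occur at
prefixes. -/
theorem exists_isPositive_forall_exits {X : Type*} {L : Subgroup (FreeGroup X)}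
    (hL : ¬ L.FiniteIndex) {V S : Set (FreeGroup X ⧸ L)} (hV : V.Finite) (hS : S.Finite) :
    ∃ u : List (X × Bool), IsPositive u ∧ ∀ v ∈ S, ∃ p, p <+: u ∧ (mk p)⁻¹ • v ∉ V := by
  induction S, hS using Set.Finite.induction_on with
  | empty => exact ⟨[], by simp [IsPositive], by simp⟩
  | @insert v S _ _ ih =>
    obtain ⟨u, hu, h⟩ := ih
    obtain ⟨w, hw, h'⟩ := exists_isPositive_smul_notMem hL hV ((mk u)⁻¹ • v)
    refine ⟨u ++ w, ?_, ?_⟩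
    · intro z hz
      rcases List.mem_append.1 hz with h | h
      · exact hu z h
      · exact hw z h
    · rintro v' (rfl | hv')
      · refine ⟨u ++ w, List.prefix_rfl, ?_⟩
        rwa [← mul_mk, mul_inv_rev, mul_smul]
      · obtain ⟨p, hp, hp'⟩ := h v' hv'
        exact ⟨p, hp.trans (List.prefix_append _ _), hp'⟩

/-- A finitely generated subgroup of infinite index avoids some positive word. -/
theorem exists_isPositive_not_infix {L : Subgroup (FreeGroup X)} (hfg : L.FG)
    (hL : ¬ L.FiniteIndex) : ∃ u, IsPositive u ∧ ∀ h ∈ L, ¬ u <:+: h.toWord := by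
  obtain ⟨V, hV, hLV⟩ := exists_finite_cosets_of_fg hfg
  obtain ⟨u, hu, h⟩ := exists_isPositive_forall_exits hL hV hV
  refine ⟨u, hu, ?_⟩
  rintro g hg ⟨A, B, e⟩
  have hA := hLV g hg A ⟨u ++ B, by simpa using e⟩
  obtain ⟨p, ⟨r, rfl⟩, hp'⟩ := h _ hA
  refine hp' ?_
  have := hLV g hg (A ++ p) ⟨r ++ B, by simpa using e⟩
  rwa [← mul_mk, mul_inv_rev] at this

theorem exists_isPositive_forall_not_infix {k : ℕ} {L : Fin k → Subgroup (FreeGroup X)}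
    (hfg : ∀ i, (L i).FG) (hL : ∀ i, ¬ (L i).FiniteIndex) :
    ∃ u, IsPositive u ∧ ∀ i, ∀ h ∈ L i, ¬ u <:+: h.toWord := by
  choose u hu h using fun i => exists_isPositive_not_infix (hfg i) (hL i)
  refine ⟨(List.ofFn u).flatten, ?_, fun i g hg hi => h i g hg (List.IsInfix.trans ?_ hi)⟩
  · intro z hz
    obtain ⟨l, hl, hz⟩ := List.mem_flatten.1 hz
    obtain ⟨i, rfl⟩ := (List.mem_ofFn' _ _).1 hl
    exact hu i z hz
  · exact List.infix_of_mem_flatten ((List.mem_ofFn' _ _).2 ⟨i, rfl⟩)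

end FreeGroup

/-! ### Cancellation in products and in conjugates of powers -/

namespace FreeGroup

variable {X : Type*}

theorem IsPositive.append {l₁ l₂ : List (X × Bool)} (h₁ : IsPositive l₁) (h₂ : IsPositive l₂) :
    IsPositive (l₁ ++ l₂) := fun z hz => (List.mem_append.1 hz).elim (h₁ z) (h₂ z)

theorem IsPositive.isReduced {l : List (X × Bool)} (h : IsPositive l) : IsReduced l := by
  induction l with
  | nil => exact .nil
  | cons a l ih =>
    cases l with
    | nil => exact .singleton
    | cons b l =>
      rw [isReduced_cons_cons]
      exact ⟨fun _ => by rw [h a (by simp), h b (by simp)], ih fun z hz => h z (by simp_all)⟩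

theorem IsReduced.invRev {l : List (X × Bool)} (h : IsReduced l) : IsReduced (invRev l) := by
  classical
  rw [isReduced_iff_reduce_eq, reduce_invRev, h.reduce_eq]

/-- If two different words of the same length are the tails of reduced words, then the product of
these reduced words with the second one inverted cancels only within the tails. -/
theorem exists_connector {t t' m m' : List (X × Bool)} (hlen : t.length = t'.length)
    (hne : t ≠ t') (h : IsReduced (m ++ t)) (h' : IsReduced (m' ++ t')) :
    ∃ d, mk d = mk t * (mk t')⁻¹ ∧ d.length ≤ 2 * t.length ∧
      IsReduced (m ++ d ++ invRev m') := by
  induction t using List.reverseRecOn generalizing t' with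
  | nil => exact absurd (List.length_eq_zero_iff.1 hlen.symm).symm hne
  | append_singleton t z ih =>
    rcases List.eq_nil_or_concat t' with rfl | ⟨t', z', rfl⟩
    · simp at hlen
    by_cases hz : z = z'
    · subst hz
      obtain ⟨d, h1, h2, h3⟩ := ih (t' := t') (by simpa using hlen) (by rintro rfl; exact hne (by simp))
        (h.infix ⟨[], [z], by simp⟩) (h'.infix ⟨[], [z], by simp⟩)
      refine ⟨d, ?_, by simp; omega, h3⟩
      rw [h1, ← mul_mk, List.concat_eq_append, ← mul_mk]
      group
    · rw [List.concat_eq_append] at *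
      refine ⟨(t ++ [z]) ++ invRev (t' ++ [z']), by rw [inv_mk, mul_mk], ?_, ?_⟩
      · simp only [List.length_append, invRev_length, List.length_singleton] at *
        omega
      · have h3 : IsReduced ([z] ++ invRev [z']) := by
          simp only [invRev, List.map_cons, List.map_nil, List.reverse_cons, List.reverse_nil,
            List.nil_append, List.singleton_append, isReduced_cons_cons, IsReduced.singleton,
            and_true]
          intro e
          by_contra hb
          refine hz (Prod.ext e ?_)
          rcases z with ⟨_, _ | _⟩ <;> rcases z' with ⟨_, _ | _⟩ <;> simp_all
        have h4 : IsReduced ([z] ++ invRev (m' ++ (t' ++ [z']))) := by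
          rw [← List.append_assoc, invRev_append, ← List.append_assoc]
          refine h3.append_overlap ?_ (by simp [invRev])
          rw [← invRev_append]
          exact h'.invRev.infix ⟨[], [], by simp⟩
        have h5 := IsReduced.append_overlap (L₁ := m ++ t) (L₂ := [z]) (by simpa using h) h4
          (by simp)
        simpa [invRev_append] using h5

/-- Multiplying any element by high powers of a cyclically reduced word, there is eventually no
cancellation. -/
theorem exists_mul_pow_isReduced (Q : List (X × Bool)) {c : List (X × Bool)} (hQ : IsReduced Q)
    (hc : c ≠ []) (hcc : IsReduced (c ++ c)) :
    ∃ (j : ℕ) (A : List (X × Bool)), mk A = mk Q * mk c ^ j ∧ IsReduced (A ++ c) := by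
  induction Q using List.reverseRecOn generalizing c with
  | nil => exact ⟨0, [], by simp [← one_eq_mk], hcc.infix ⟨[], c, by simp⟩⟩
  | append_singleton Q z ih =>
    obtain ⟨y, e, rfl⟩ := List.exists_cons_of_ne_nil hc
    by_cases hyz : z.1 = y.1 → z.2 = y.2
    · refine ⟨0, Q ++ [z], by simp, ?_⟩
      have h1 : IsReduced ([z] ++ (y :: e)) := by
        simp only [List.singleton_append, isReduced_cons_cons]
        exact ⟨hyz, hcc.infix ⟨[], y :: e, by simp⟩⟩
      exact hQ.append_overlap h1 (by simp)
    · have hy : mk [y] = (mk [z])⁻¹ := by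
        rw [inv_mk]
        push Not at hyz
        congr 1
        simp only [invRev, List.map_cons, List.map_nil, List.reverse_cons, List.reverse_nil,
          List.nil_append, List.cons.injEq, and_true]
        refine Prod.ext hyz.1.symm ?_
        have := hyz.2
        rcases z with ⟨_, _ | _⟩ <;> rcases y with ⟨_, _ | _⟩ <;> simp_all
      -- The last letter of `Q ++ [z]` cancels the first letter of `c`; conjugating by it rotates
      -- `c` to `e ++ [y]`, still cyclically reduced, and leaves the shorter word `Q`.
      have h3 : IsReduced ((y :: e) ++ (y :: e) ++ (y :: e)) := hcc.append_overlap hcc (by simp)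
      obtain ⟨j, A, hA, hred⟩ := ih (c := e ++ [y]) (hQ.infix ⟨[], [z], by simp⟩) (by simp)
        (h3.infix ⟨[y], e, by simp⟩)
      have hrot : mk (y :: e) = mk [y] * mk e := by rw [mul_mk]; rfl
      refine ⟨j + 1, A ++ e, ?_, ?_⟩
      · have h4 : mk (e ++ [y]) = mk [z] * mk (y :: e) * (mk [z])⁻¹ := by
          rw [hrot, ← mul_mk, hy]; group
        have h5 : mk e = mk [z] * mk (y :: e) := by rw [hrot, hy]; group
        rw [← mul_mk, hA, h4, conj_pow, ← mul_mk, pow_succ, h5]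
        group
      · have h4 : IsReduced ([y] ++ e) := hcc.infix ⟨[], y :: e, by simp⟩
        have h5 : IsReduced ((A ++ e) ++ [y] ++ e) :=
          IsReduced.append_overlap (by simpa using hred) h4 (by simp)
        simpa using h5

/-- A reduced word of a conjugate of a high power of a cyclically reduced word contains this
word. -/
theorem exists_isReduced_conj_pow (q : FreeGroup X) {c : List (X × Bool)} (hc : c ≠ [])
    (hcc : IsReduced (c ++ c)) :
    ∃ (j M : ℕ) (A B : List (X × Bool)), mk A = q * mk c ^ j ∧ IsReduced (A ++ c ++ B) ∧
      mk (A ++ c ++ B) = q * mk c ^ M * q⁻¹ := by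
  classical
  obtain ⟨j, A, hA, hAc⟩ := exists_mul_pow_isReduced q.toWord isReduced_toWord hc hcc
  obtain ⟨i, B, hB, hBc⟩ := exists_mul_pow_isReduced q.toWord (c := invRev c) isReduced_toWord
    (fun h => hc (by simpa using congrArg invRev h)) (by simpa using hcc.invRev)
  rw [mk_toWord] at hA hB
  refine ⟨j, j + 1 + i, A, invRev B, hA, hAc.append_overlap (by simpa using hBc.invRev) hc, ?_⟩
  rw [← mul_mk, ← mul_mk, ← inv_mk, hA, hB, ← inv_mk]
  simp only [mul_inv_rev, inv_pow, inv_inv, pow_add, pow_one]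
  group

/-! ### Overlaps of marker blocks -/

theorem getElem?_append_cons_replicate {γ : Type*} {a b : γ} {M k : ℕ} {A B : List γ}
    (h₁ : A.length < k) (h₂ : k ≤ A.length + M) :
    (A ++ b :: (List.replicate M a ++ B))[k]? = some a := by
  obtain ⟨s, rfl⟩ := Nat.exists_eq_add_of_lt h₁
  rw [List.getElem?_append_right (by omega), show A.length + s + 1 - A.length = s + 1 by omega,
    List.getElem?_cons_succ, List.getElem?_append_left (by simp; omega), List.getElem?_replicate,
    if_pos (by omega)]

theorem eq_of_replicate_append_cons {γ : Type*} {a b : γ} (hab : a ≠ b) {M M' : ℕ} {B R : List γ}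
    (h : List.replicate M a ++ b :: B = List.replicate M' a ++ b :: R) : M = M' := by
  induction M generalizing M' with
  | zero =>
    cases M' with
    | zero => rfl
    | succ M' =>
      simp only [List.replicate_zero, List.nil_append, List.replicate_succ, List.cons_append,
        List.cons.injEq] at h
      exact absurd h.1.symm hab
  | succ M ih =>
    cases M' with
    | zero =>
      simp only [List.replicate_zero, List.nil_append, List.replicate_succ, List.cons_append,
        List.cons.injEq] at h
      exact absurd h.1 hab
    | succ M' =>
      simp only [List.replicate_succ, List.cons_append, List.cons.injEq, true_and] at h
      rw [ih h]

/-- Occurrences of blocks `b aᴹ b` in a word starting with a short segment before such a block. -/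
theorem block_occurrence {γ : Type*} {a b a' b' : γ} {M M' : ℕ} {A B Z R : List γ}
    (hab' : a ≠ b') (hb : a' ≠ b) (hZ : Z.length ≤ M)
    (h : A ++ b :: (List.replicate M a ++ b :: B) =
      Z ++ b' :: (List.replicate M' a' ++ b' :: R)) :
    (A = Z ∧ b = b' ∧ (a = a' → M = M')) ∨
      ∃ A', A = Z ++ b' :: (List.replicate M' a' ++ A') ∧
        A' ++ b :: (List.replicate M a ++ b :: B) = b' :: R := by
  rcases lt_trichotomy A.length Z.length with hl | hl | hl
  -- As `Z` is no longer than the run, the letter `b'` after `Z` would fall inside the run of `a`.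
  · have h1 := congrArg (fun l => l[Z.length]?) h
    simp only [getElem?_append_cons_replicate hl (hZ.trans (Nat.le_add_left _ _))] at h1
    simp only [le_refl, List.getElem?_append_right, Nat.sub_self, List.getElem?_cons_zero] at h1
    exact absurd (Option.some.inj h1) hab'
  · left
    obtain ⟨hAZ, h2⟩ := List.append_inj h hl
    obtain ⟨hbb, h3⟩ := List.cons.inj h2
    refine ⟨hAZ, hbb, ?_⟩
    rintro rfl
    rw [← hbb] at h3
    exact eq_of_replicate_append_cons (hbb ▸ hab') h3
  · right
    have hle : Z.length + (M' + 1) ≤ A.length := by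
      -- Otherwise the `b` after `A` would fall inside the run of `a'`.
      by_contra hlt
      have h1 := congrArg (fun l => l[A.length]?) h
      simp only [getElem?_append_cons_replicate (M := M') (A := Z) hl (by omega)] at h1
      simp only [le_refl, List.getElem?_append_right, Nat.sub_self, List.getElem?_cons_zero] at h1
      exact hb (Option.some.inj h1).symm
    have h' : A ++ (b :: (List.replicate M a ++ b :: B)) =
        (Z ++ (b' :: List.replicate M' a')) ++ (b' :: R) := by simpa using h
    rcases List.append_eq_append_iff.1 h' with ⟨s, h1, h2⟩ | ⟨s, h1, h2⟩
    · have h3 := congrArg List.length h1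
      simp only [List.length_append, List.length_cons, List.length_replicate] at h3
      have h4 : s = [] := List.length_eq_zero_iff.1 (by omega)
      subst h4
      exact ⟨[], by simpa using h1.symm, by simpa using h2⟩
    · exact ⟨s, by simpa using h1, by simpa using h2.symm⟩

end FreeGroup

/-! ### The substituted words -/

namespace FreeGroup

/-- Two letters and a positive word, from which we build `n` positive words, each containing the
given word and a marker formed by a long run of the first letter between two copies of the
second one. -/
structure MarkerData (X : Type*) where
  make ::
  /-- The letter of the long runs. -/
  a : X
  /-- The letter delimiting the long runs. -/
  b : X
  hab : a ≠ b
  /-- The word to be contained in all the words. -/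
  u : List (X × Bool)
  hu : IsPositive u

namespace MarkerData

variable {X : Type*} {n : ℕ} (D : MarkerData X)

/-- The formal inverse of a letter. -/
def flip (x : Fin n × Bool) : Fin n × Bool := (x.1, !x.2)

/-- The common beginning and end of the `i`-th word. -/
def tail (i : Fin n) : List (X × Bool) :=
  List.replicate i (D.a, true) ++ List.replicate (n - i) (D.b, true)

/-- The end of the word substituted for a letter. -/
def ending (x : Fin n × Bool) : List (X × Bool) :=
  if x.2 then D.tail x.1 else invRev (D.tail x.1)

/-- The part of the core of the word substituted for a letter preceding the marker. -/
def pre (x : Fin n × Bool) : List (X × Bool) := if x.2 then (D.b, true) :: D.u else []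

/-- The part of the core of the word substituted for a letter following the marker. -/
def post (x : Fin n × Bool) : List (X × Bool) := if x.2 then [] else invRev ((D.b, true) :: D.u)

/-- The length of the run in the marker of a letter. -/
def runLength (x : Fin n × Bool) : ℕ := 2 * D.u.length + 2 * n + 10 + x.1

/-- The core of the word substituted for a letter. -/
def core (x : Fin n × Bool) : List (X × Bool) :=
  D.pre x ++ (D.b, x.2) :: (List.replicate (D.runLength x) (D.a, x.2) ++ (D.b, x.2) :: D.post x)

/-- The word substituted for a letter. -/
def letterWord (x : Fin n × Bool) : List (X × Bool) :=
  invRev (D.ending (flip x)) ++ D.core x ++ D.ending x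

/-- The substitution homomorphism. -/
def subst (n : ℕ) : FreeGroup (Fin n) →* FreeGroup X := lift fun i => mk (D.letterWord (i, true))

theorem flip_flip (x : Fin n × Bool) : flip (flip x) = x := by simp [flip]

theorem ne_flip_iff {x y : Fin n × Bool} : y ≠ flip x ↔ (x.1 = y.1 → x.2 = y.2) := by
  obtain ⟨i, e⟩ := x
  obtain ⟨j, f⟩ := y
  cases e <;> cases f <;> simp [flip, eq_comm]

theorem ext_of_runLength_eq {x y : Fin n × Bool} (h₁ : D.runLength x = D.runLength y)
    (h₂ : x.2 = y.2) : x = y :=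
  Prod.ext (Fin.ext (by simpa [runLength] using h₁)) h₂

theorem length_tail (i : Fin n) : (D.tail i).length = n := by simp [tail]

theorem length_ending (x : Fin n × Bool) : (D.ending x).length = n := by
  unfold ending; split <;> simp [length_tail]

theorem length_pre_le (x : Fin n × Bool) : (D.pre x).length ≤ D.u.length + 1 := by
  unfold pre; split <;> simp

theorem length_post_le (x : Fin n × Bool) : (D.post x).length ≤ D.u.length + 1 := by
  unfold post; split <;> simp

theorem core_ne_nil (x : Fin n × Bool) : D.core x ≠ [] := by simp [core]

theorem invRev_ending_flip (x : Fin n × Bool) : invRev (D.ending x) = D.ending (flip x) := by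
  rcases x with ⟨i, _ | _⟩ <;> simp [ending, flip]

theorem invRev_core (x : Fin n × Bool) : invRev (D.core x) = D.core (flip x) := by
  rcases x with ⟨i, _ | _⟩ <;>
    simp [core, flip, pre, post, runLength, invRev, Function.comp_def]

theorem invRev_letterWord (x : Fin n × Bool) :
    invRev (D.letterWord x) = D.letterWord (flip x) := by
  simp [letterWord, invRev_append, invRev_core, flip_flip, invRev_ending_flip]

theorem isPositive_tail (i : Fin n) : IsPositive (D.tail i) := by
  intro z hz
  simp only [tail, List.mem_append, List.mem_replicate] at hz
  rcases hz with ⟨-, rfl⟩ | ⟨-, rfl⟩ <;> rfl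

theorem isReduced_letterWord (x : Fin n × Bool) : IsReduced (D.letterWord x) := by
  have h : ∀ i : Fin n, IsPositive (D.letterWord (i, true)) := by
    intro i
    have hc : IsPositive (D.core (i, true)) := by
      intro z hz
      simp only [core, pre, post, if_true, List.mem_append, List.mem_cons, List.mem_replicate,
        List.not_mem_nil, or_false] at hz
      rcases hz with (rfl | h) | rfl | ⟨-, rfl⟩ | rfl
      exacts [rfl, D.hu z h, rfl, rfl, rfl]
    have he : invRev (D.ending (flip (i, true))) = D.tail i := by simp [ending, flip]
    unfold letterWord
    rw [he]
    exact ((D.isPositive_tail i).append hc).append (by simpa [ending] using D.isPositive_tail i)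
  rcases x with ⟨i, _ | _⟩
  · have := (h i).isReduced.invRev
    rwa [invRev_letterWord] at this
  · exact (h i).isReduced

theorem isReduced_core_append_ending (x : Fin n × Bool) :
    IsReduced (D.core x ++ D.ending x) :=
  (D.isReduced_letterWord x).infix ⟨invRev (D.ending (flip x)), [], by simp [letterWord]⟩

theorem isReduced_invRev_ending_append_core (x : Fin n × Bool) :
    IsReduced (invRev (D.ending (flip x)) ++ D.core x) :=
  (D.isReduced_letterWord x).infix ⟨[], D.ending x, by simp [letterWord]⟩

theorem subst_mk_singleton (x : Fin n × Bool) : D.subst n (mk [x]) = mk (D.letterWord x) := by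
  rcases x with ⟨i, _ | _⟩
  · have : (mk [(i, false)] : FreeGroup (Fin n)) = (of i)⁻¹ := rfl
    rw [this, _root_.map_inv, subst, lift_apply_of, inv_mk, invRev_letterWord]
    rfl
  · exact lift_apply_of

theorem mk_core (x : Fin n × Bool) :
    mk (D.core x) = mk (D.ending (flip x)) * D.subst n (mk [x]) * (mk (D.ending x))⁻¹ := by
  rw [subst_mk_singleton, letterWord, ← mul_mk, ← mul_mk, ← inv_mk]
  group

theorem infix_core (x : Fin n × Bool) : D.u <:+: D.core x ∨ invRev D.u <:+: D.core x := by
  rcases x with ⟨i, _ | _⟩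
  · right
    refine ⟨(D.b, false) :: (List.replicate (D.runLength (i, false)) (D.a, false) ++
      [(D.b, false)]), invRev [(D.b, true)], ?_⟩
    simp only [core, pre, post, Bool.false_eq_true, if_false]
    rw [invRev_cons (L := D.u)]
    simp
  · left
    exact (List.infix_cons List.infix_rfl).trans (List.prefix_append ((D.b, true) :: D.u) _).isInfix

/-! ### Reduced words of the image and malnormality -/

variable [DecidableEq X]

/-- Each tail is positive and contains `b`, so it is not the inverse of a tail; the number of
occurrences of `b` recovers the index. With equal lengths, this confines cancellation to the tails.
-/
theorem ending_injective : Function.Injective (D.ending (n := n)) := by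
  have h1 : ∀ i : Fin n, (D.tail i).count (D.b, true) = n - i := by
    intro i
    simp [tail, List.count_append, List.count_replicate, D.hab]
  have h2 : ∀ i : Fin n, (D.b, true) ∈ D.tail i := by
    intro i
    have := i.2
    simp [tail]; omega
  have h3 : ∀ i j : Fin n, D.tail i ≠ invRev (D.tail j) := by
    intro i j h
    have := h2 i
    rw [h, invRev, List.mem_reverse, List.mem_map] at this
    obtain ⟨z, hz, e⟩ := this
    have h4 := D.isPositive_tail j z hz
    simp [h4] at e
  have h4 : ∀ i j : Fin n, D.tail i = D.tail j → i = j := by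
    intro i j h
    have h5 := h1 i
    rw [h, h1 j] at h5
    have := i.2
    have := j.2
    exact Fin.ext (by omega)
  rintro ⟨i, _ | _⟩ ⟨j, _ | _⟩ h <;> simp [ending] at h
  · rw [h4 i j (invRev_injective h)]
  · exact absurd h.symm (h3 j i)
  · exact absurd h (h3 i j)
  · rw [h4 i j h]

/-- The reduced word between the cores of two consecutive letters. -/
def connector (x y : Fin n × Bool) : List (X × Bool) :=
  (mk (D.ending x) * (mk (D.ending (flip y)))⁻¹).toWord

theorem mk_connector (x y : Fin n × Bool) :
    mk (D.connector x y) = mk (D.ending x) * (mk (D.ending (flip y)))⁻¹ := mk_toWord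

theorem length_connector_le (x y : Fin n × Bool) : (D.connector x y).length ≤ 2 * n := by
  have h1 := norm_mul_le (mk (D.ending x)) (mk (D.ending (flip y)))⁻¹
  rw [norm_inv_eq] at h1
  have h2 : norm (mk (D.ending x)) ≤ _ := norm_mk_le
  have h3 : norm (mk (D.ending (flip y))) ≤ _ := norm_mk_le
  rw [length_ending] at h2 h3
  have h4 : (D.connector x y).length = norm (mk (D.ending x) * (mk (D.ending (flip y)))⁻¹) := rfl
  omega

theorem isReduced_core_connector_core {x y : Fin n × Bool} (h : y ≠ flip x) :
    IsReduced (D.core x ++ D.connector x y ++ D.core y) := by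
  obtain ⟨d, hd, -, hr⟩ := exists_connector (t := D.ending x) (t' := D.ending (flip y))
    (m := D.core x) (m' := D.core (flip y)) (by simp only [length_ending])
    (fun e => h (by rw [D.ending_injective e, flip_flip])) (D.isReduced_core_append_ending x)
    (D.isReduced_core_append_ending (flip y))
  have h1 : D.connector x y = d := by
    rw [connector, ← hd, toWord_mk]
    exact (hr.infix ⟨D.core x, _, rfl⟩).reduce_eq
  rwa [invRev_core, flip_flip, ← h1] at hr

/-- The reduced word of the image of a reduced word, with the beginning removed. -/
def word : Fin n × Bool → List (Fin n × Bool) → List (X × Bool)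
  | x, [] => D.core x ++ D.ending x
  | x, y :: l => D.core x ++ D.connector x y ++ word y l

/-- The part of the reduced word of the image of a reduced word between the cores of two letters,
with the first one included and the second one excluded. -/
def segment : Fin n × Bool → List (Fin n × Bool) → Fin n × Bool → List (X × Bool)
  | x, [], z => D.core x ++ D.connector x z
  | x, y :: l, z => D.core x ++ D.connector x y ++ segment y l z

theorem word_append_cons (x z : Fin n × Bool) (l l' : List (Fin n × Bool)) :
    D.word x (l ++ z :: l') = D.segment x l z ++ D.word z l' := by
  induction l generalizing x with
  | nil => rfl
  | cons y l ih => simp [word, segment, ih]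

theorem core_prefix_word (x : Fin n × Bool) (l : List (Fin n × Bool)) :
    D.core x <+: D.word x l := by
  cases l <;> simp [word]

theorem core_prefix_segment (x z : Fin n × Bool) (l : List (Fin n × Bool)) :
    D.core x <+: D.segment x l z := by
  cases l <;> simp [segment]

theorem isReduced_word {x : Fin n × Bool} {l : List (Fin n × Bool)} (h : IsReduced (x :: l)) :
    IsReduced (D.word x l) := by
  induction l generalizing x with
  | nil => exact D.isReduced_core_append_ending x
  | cons y l ih =>
    rw [isReduced_cons_cons, ← ne_flip_iff] at h
    obtain ⟨r, hr⟩ := D.core_prefix_word y l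
    have h1 := ih h.2
    rw [← hr] at h1
    have := (D.isReduced_core_connector_core h.1).append_overlap h1 (D.core_ne_nil y)
    simpa [word, ← hr] using this

theorem isReduced_invRev_ending_append_word {x : Fin n × Bool} {l : List (Fin n × Bool)}
    (h : IsReduced (x :: l)) : IsReduced (invRev (D.ending (flip x)) ++ D.word x l) := by
  obtain ⟨r, hr⟩ := D.core_prefix_word x l
  have h1 := D.isReduced_word h
  rw [← hr] at h1 ⊢
  rw [← List.append_assoc]
  exact (D.isReduced_invRev_ending_append_core x).append_overlap h1 (D.core_ne_nil x)

theorem mk_word (x : Fin n × Bool) (l : List (Fin n × Bool)) :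
    mk (D.word x l) = mk (D.ending (flip x)) * D.subst n (mk (x :: l)) := by
  induction l generalizing x with
  | nil =>
    rw [word, ← mul_mk, mk_core]
    group
  | cons y l ih =>
    have : (mk (x :: y :: l) : FreeGroup (Fin n)) = mk [x] * mk (y :: l) := by
      rw [mul_mk]; rfl
    rw [word, ← mul_mk, ← mul_mk, mk_core, mk_connector, ih, this, _root_.map_mul]
    group

theorem mk_segment (x z : Fin n × Bool) (l : List (Fin n × Bool)) :
    mk (D.segment x l z) =
      mk (D.ending (flip x)) * D.subst n (mk (x :: l)) * (mk (D.ending (flip z)))⁻¹ := by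
  have h := congrArg mk (D.word_append_cons x z l [])
  rw [← mul_mk, mk_word, mk_word, ← List.cons_append, ← mul_mk, _root_.map_mul] at h
  rw [eq_mul_inv_iff_mul_eq, ← mul_left_inj (D.subst n (mk [z])), mul_assoc, ← h, mul_assoc]

theorem toWord_subst_mk_cons {x : Fin n × Bool} {l : List (Fin n × Bool)}
    (h : IsReduced (x :: l)) :
    (D.subst n (mk (x :: l))).toWord = invRev (D.ending (flip x)) ++ D.word x l := by
  rw [← (D.isReduced_invRev_ending_append_word h).reduce_eq, ← toWord_mk, ← mul_mk, mk_word,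
    ← inv_mk, inv_mul_cancel_left]

theorem subst_injective : Function.Injective (D.subst n) := by
  rw [injective_iff_map_eq_one]
  intro y hy
  rw [← mk_toWord (x := y)] at hy ⊢
  have hr : IsReduced y.toWord := isReduced_toWord
  cases h : y.toWord with
  | nil => rfl
  | cons x l =>
    rw [h] at hy hr
    have h1 := D.toWord_subst_mk_cons hr
    obtain ⟨r, h2⟩ := D.core_prefix_word x l
    rw [hy, toWord_one, ← h2] at h1
    have := congrArg List.length h1
    simp [core] at this

/-- Markers only occur at the expected places in the image of a word. -/
theorem marker_occurrence {x s : Fin n × Bool} {l : List (Fin n × Bool)} {A B Z : List (X × Bool)}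
    (hZ : Z.length ≤ D.u.length + 2 * n + 5)
    (h : A ++ D.core s ++ B = Z ++ D.word x l) :
    ∃ f : FreeGroup (Fin n),
      mk A = mk Z * mk (D.ending (flip x)) * D.subst n f * (mk (D.ending (flip s)))⁻¹ := by
  have key : ∀ {x : Fin n × Bool} {l : List (Fin n × Bool)} {A B Z : List (X × Bool)},
      Z.length ≤ D.u.length + 2 * n + 5 →
      A ++ (D.b, s.2) :: (List.replicate (D.runLength s) (D.a, s.2) ++ (D.b, s.2) :: B) =
        Z ++ D.word x l → ∃ f : FreeGroup (Fin n), mk A =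
        mk Z * mk (D.ending (flip x)) * D.subst n f * (mk (D.ending (flip s)))⁻¹ *
          mk (D.pre s) := by
    intro x l
    induction l generalizing x with
    | nil =>
      intro A B Z hZ h
      have h1 := D.length_pre_le x
      have h2 := D.length_post_le x
      -- `Z ++ D.pre x` has length at most `2|u| + 2n + 6`, below every run length.
      rcases block_occurrence (Z := Z ++ D.pre x) (b' := (D.b, x.2)) (a' := (D.a, x.2))
        (M' := D.runLength x) (R := D.post x ++ D.ending x) (by simp [D.hab]) (by simp [D.hab])
        (by simp [runLength]; omega) (h.trans (by simp [word, core])) with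
        ⟨rfl, h3, h4⟩ | ⟨A', -, h3⟩
      · have h6 : s.2 = x.2 := (Prod.mk.inj h3).2
        obtain rfl : s = x := D.ext_of_runLength_eq (h4 (by rw [h6])) h6
        exact ⟨1, by rw [← mul_mk, _root_.map_one]; group⟩
      -- What follows the last marker is too short to hold another run.
      · have h4 := congrArg List.length h3
        simp [length_ending, runLength] at h4
        omega
    | cons y l ih =>
      intro A B Z hZ h
      have h1 := D.length_pre_le x
      have h2 := D.length_post_le x
      have h5 := D.length_connector_le x y
      rcases block_occurrence (Z := Z ++ D.pre x) (b' := (D.b, x.2)) (a' := (D.a, x.2))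
        (M' := D.runLength x) (R := D.post x ++ D.connector x y ++ D.word y l) (by simp [D.hab])
        (by simp [D.hab])
        (by simp [runLength]; omega) (h.trans (by simp [word, core])) with
        ⟨rfl, h3, h4⟩ | ⟨A', rfl, h3⟩
      · have h6 : s.2 = x.2 := (Prod.mk.inj h3).2
        obtain rfl : s = x := D.ext_of_runLength_eq (h4 (by rw [h6])) h6
        exact ⟨1, by rw [← mul_mk, _root_.map_one]; group⟩
      -- The closing `b` of this marker may open the next occurrence, so it is kept in the new `Z`.
      · obtain ⟨f, hf⟩ := ih (x := y) (A := A') (B := B)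
          (Z := (D.b, x.2) :: (D.post x ++ D.connector x y)) (by simp; omega)
          (h3.trans (by simp))
        refine ⟨mk [x] * f, ?_⟩
        have h6 : mk (D.core x) = mk (D.pre x ++ (D.b, x.2) ::
            List.replicate (D.runLength x) (D.a, x.2)) * mk ((D.b, x.2) :: D.post x) := by
          simp [core]
        have h8 : mk (Z ++ D.pre x ++ (D.b, x.2) ::
            (List.replicate (D.runLength x) (D.a, x.2) ++ A')) = mk Z * mk (D.pre x ++ (D.b, x.2) ::
            List.replicate (D.runLength x) (D.a, x.2)) * mk A' := by
          simp
        have h9 : mk ((D.b, x.2) :: (D.post x ++ D.connector x y)) =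
            mk ((D.b, x.2) :: D.post x) * mk (D.connector x y) := by
          simp
        have h10 : D.subst n (mk [x]) = (mk (D.ending (flip x)))⁻¹ * mk (D.core x) *
            mk (D.ending x) := by
          rw [mk_core]; group
        rw [h8, hf, h9, mk_connector, _root_.map_mul, h10, h6]
        group
  obtain ⟨f, hf⟩ := key (x := x) (l := l) (A := A ++ D.pre s) (B := D.post s ++ B) (Z := Z) hZ
    (by simpa [core] using h)
  refine ⟨f, mul_right_cancel (b := mk (D.pre s)) ?_⟩
  rw [← hf, mul_mk]

/-- Up to conjugation, a nontrivial element of the image of the substitution is given by a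
cyclically reduced word starting with the core of a letter. -/
theorem exists_subst_eq_conj {y : FreeGroup (Fin n)} (hy : y ≠ 1) :
    ∃ (k : FreeGroup (Fin n)) (x : Fin n × Bool) (c : List (X × Bool)),
      D.core x <+: c ∧ IsReduced (c ++ c) ∧
      D.subst n y = (D.subst n k * (mk (D.ending (flip x)))⁻¹) * mk c *
        (D.subst n k * (mk (D.ending (flip x)))⁻¹)⁻¹ := by
  have hconj := reduceCyclically.conj_conjugator_reduceCyclically y.toWord
  have hcyc := reduceCyclically.isCyclicallyReduced (isReduced_toWord (x := y))
  set k := reduceCyclically.conjugator y.toWord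
  have hy' : y = mk k * mk (reduceCyclically y.toWord) * (mk k)⁻¹ := by
    rw [inv_mk, mul_mk, mul_mk, hconj, mk_toWord]
  cases hr : reduceCyclically y.toWord with
  | nil => rw [hr, ← one_eq_mk, mul_one, mul_inv_cancel] at hy'; exact absurd hy' hy
  | cons x l =>
    rw [hr] at hy' hcyc
    refine ⟨mk k, x, D.segment x l x, D.core_prefix_segment x x l, ?_, ?_⟩
    -- The third `x` is needed so that the word contains two full segments, each ending just before
    -- a core.
    · have h3 : IsReduced (x :: (l ++ x :: (l ++ [x]))) := by
        have := (hcyc.flatten_replicate 3).isReduced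
        exact this.infix ⟨[], l, by simp [List.replicate_succ]⟩
      have h4 := D.isReduced_word h3
      rw [word_append_cons, word_append_cons] at h4
      exact h4.infix ⟨[], D.word x [], by simp⟩
    · rw [mk_segment]
      nth_rewrite 1 [hy']
      simp only [_root_.map_mul, _root_.map_inv]
      group

/-- Conjugates of the image of the substitution contain long parts of its words. -/
theorem exists_isReduced_core {y : FreeGroup (Fin n)} (hy : y ≠ 1) (g : FreeGroup X) :
    ∃ (f : FreeGroup (Fin n)) (x : Fin n × Bool) (A B : List (X × Bool)) (M : ℕ),
      IsReduced (A ++ D.core x ++ B) ∧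
      mk A = g * D.subst n f * (mk (D.ending (flip x)))⁻¹ ∧
      mk (A ++ D.core x ++ B) = (g * D.subst n y * g⁻¹) ^ M := by
  obtain ⟨k, x, c, ⟨r, rfl⟩, hcc, hk⟩ := D.exists_subst_eq_conj hy
  set q := D.subst n k * (mk (D.ending (flip x)))⁻¹ with hq
  obtain ⟨j, M, A, B, hA, hred, hM⟩ := exists_isReduced_conj_pow (g * q)
    (c := D.core x ++ r) (by simp [core]) hcc
  refine ⟨y ^ j * k, x, A, r ++ B, M, by simpa using hred, ?_, ?_⟩
  · rw [hA, _root_.map_mul, _root_.map_pow, hk, conj_pow, hq]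
    group
  · rw [hk, show A ++ D.core x ++ (r ++ B) = A ++ (D.core x ++ r) ++ B by simp, hM,
      show g * (q * mk (D.core x ++ r) * q⁻¹) * g⁻¹ =
        (g * q) * mk (D.core x ++ r) * (g * q)⁻¹ by group, conj_pow]

theorem isMalnormal_range_subst : IsMalnormal (D.subst n).range := by
  intro g hg
  rw [eq_bot_iff]
  rintro z ⟨⟨y, rfl⟩, hz⟩
  obtain ⟨h, hh, e⟩ := (mem_conjSubgroup _ _ _).1 hz
  rw [Subgroup.mem_bot]
  by_contra hne
  have hy : y ≠ 1 := by rintro rfl; exact hne (_root_.map_one _)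
  obtain ⟨f, x, A, B, M, hred, hA, hM⟩ := D.exists_isReduced_core hy g
  have h1 : g * D.subst n y * g⁻¹ = h := by rw [← e]; group
  rw [h1] at hM
  obtain ⟨y', hy'⟩ := pow_mem hh M
  have hw : (D.subst n y').toWord = A ++ D.core x ++ B := by
    rw [hy', ← hM, toWord_mk, hred.reduce_eq]
  rw [← mk_toWord (x := y')] at hw
  have hr : IsReduced y'.toWord := isReduced_toWord
  cases hl : y'.toWord with
  | nil =>
    rw [hl, ← one_eq_mk, _root_.map_one, toWord_one] at hw
    simp [core] at hw
  | cons x' l =>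
    rw [hl] at hw hr
    rw [D.toWord_subst_mk_cons hr] at hw
    obtain ⟨f', hf'⟩ := D.marker_occurrence (by rw [invRev_length, length_ending]; omega) hw.symm
    -- Both expressions for the prefix `A` end in the same inverse ending; cancelling it leaves `g *
    -- D.subst n f = D.subst n f'`.
    rw [hA, ← inv_mk, inv_mul_cancel, one_mul, mul_left_inj] at hf'
    refine hg ⟨f' * f⁻¹, ?_⟩
    rw [_root_.map_mul, _root_.map_inv, ← hf']
    group

theorem inf_conjSubgroup_range_subst {L : Subgroup (FreeGroup X)}
    (hL : ∀ h ∈ L, ¬ D.u <:+: h.toWord) (g : FreeGroup X) :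
    L ⊓ conjSubgroup (D.subst n).range g = ⊥ := by
  rw [eq_bot_iff]
  rintro z ⟨hzL, hz⟩
  obtain ⟨_, ⟨y, rfl⟩, e⟩ := (mem_conjSubgroup _ _ _).1 hz
  rw [Subgroup.mem_bot]
  by_contra hne
  have hy : y ≠ 1 := by
    rintro rfl
    refine hne ?_
    rw [← e, _root_.map_one]
    group
  obtain ⟨f, x, A, B, M, hred, -, hM⟩ := D.exists_isReduced_core hy g⁻¹
  rw [inv_inv, e] at hM
  have hmem := pow_mem hzL M
  have hw : (z ^ M).toWord = A ++ D.core x ++ B := by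
    rw [← hM, toWord_mk, hred.reduce_eq]
  have hin : D.core x <:+: (z ^ M).toWord := hw ▸ ⟨A, B, rfl⟩
  rcases D.infix_core x with h | h
  · exact hL _ hmem (h.trans hin)
  · obtain ⟨P, Q, hPQ⟩ := h.trans hin
    refine hL _ (inv_mem hmem) ⟨invRev Q, invRev P, ?_⟩
    rw [toWord_inv, ← hPQ]
    simp [invRev_append]

end MarkerData

/-! ### Conclusion and transport to an abstract free group -/

theorem exists_ne_of_not_isCyclic {X : Type*} (h : ¬ IsCyclic (FreeGroup X)) :
    ∃ a b : X, a ≠ b := by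
  by_contra! hX
  refine h ?_
  rcases isEmpty_or_nonempty X with _ | ⟨⟨x⟩⟩
  · infer_instance
  · have : Unique X := ⟨⟨x⟩, fun y => hX y x⟩
    infer_instance

/-- A noncyclic free group has malnormal free subgroups of any finite rank whose conjugates avoid
finitely many given finitely generated subgroups of infinite index. -/
theorem exists_isMalnormal {X : Type*} (hX : ¬ IsCyclic (FreeGroup X)) (n : ℕ) {k : ℕ}
    {L : Fin k → Subgroup (FreeGroup X)} (hfg : ∀ i, (L i).FG)
    (hL : ∀ i, ¬ (L i).FiniteIndex) :
    ∃ H : Subgroup (FreeGroup X), IsMalnormal H ∧ IsFreeOfRank H n ∧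
      ∀ i, ∀ g, L i ⊓ conjSubgroup H g = ⊥ := by
  classical
  obtain ⟨a, b, hab⟩ := exists_ne_of_not_isCyclic hX
  obtain ⟨u, hu, hLu⟩ := exists_isPositive_forall_not_infix hfg hL
  let D : MarkerData X := ⟨a, b, hab, u, hu⟩
  exact ⟨(D.subst n).range, D.isMalnormal_range_subst,
    ⟨⟨(MonoidHom.ofInjective D.subst_injective).symm⟩⟩,
    fun i g => D.inf_conjSubgroup_range_subst (hLu i) g⟩

end FreeGroup

theorem conjSubgroup_map {G G' : Type*} [Group G] [Group G'] (e : G ≃* G') (H : Subgroup G)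
    (g : G) :
    conjSubgroup (H.map e.toMonoidHom) (e g) = (conjSubgroup H g).map e.toMonoidHom := by
  ext x
  simp only [mem_conjSubgroup, Subgroup.mem_map]
  constructor
  · rintro ⟨_, ⟨h, hh, rfl⟩, rfl⟩
    exact ⟨g⁻¹ * h * g, ⟨h, hh, rfl⟩, by simp⟩
  · rintro ⟨_, ⟨h, hh, rfl⟩, rfl⟩
    exact ⟨_, ⟨h, hh, rfl⟩, by simp⟩

theorem proposition5p2 (n : ℕ) (hn : 1 ≤ n)
    {F : Type*} [Group F] [IsFreeGroup F] [Group.FG F] (hF : ¬ IsCyclic F)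
    (k : ℕ) (F' : Fin k → Subgroup F)
    (hfg : ∀ i, (F' i).FG) (hind : ∀ i, ¬ (F' i).FiniteIndex) :
    ∃ H : Subgroup F, IsMalnormal H ∧ IsFreeOfRank H n ∧
      ∀ i, ∀ g : F, F' i ⊓ conjSubgroup H g = ⊥ := by
  let e : FreeGroup (IsFreeGroup.Generators F) ≃* F := IsFreeGroup.mulEquiv F
  have hX : ¬ IsCyclic (FreeGroup (IsFreeGroup.Generators F)) :=
    fun h => hF (isCyclic_of_surjective e e.surjective)
  have hmap : ∀ i, ((F' i).map e.symm.toMonoidHom).map e.toMonoidHom = F' i := fun i => by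
    rw [Subgroup.map_map]; simp
  obtain ⟨H, hmal, ⟨b⟩, hav⟩ := FreeGroup.exists_isMalnormal hX n
    (L := fun i => (F' i).map e.symm.toMonoidHom)
    (fun i => by
      obtain ⟨S, hS⟩ := hfg i
      classical
      refine ⟨S.image e.symm.toMonoidHom, ?_⟩
      rw [Finset.coe_image, ← MonoidHom.map_closure, hS])
    (fun i h => hind i ⟨by
      have := h.index_ne_zero
      rwa [show (F' i).map e.symm.toMonoidHom = (F' i).map (e.symm : F →* _) from rfl,
        Subgroup.index_map_equiv] at this⟩)
  refine ⟨H.map e.toMonoidHom, ?_, ⟨b.map (e.subgroupMap H)⟩, ?_⟩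
  · intro g hg
    obtain ⟨g, rfl⟩ := e.surjective g
    rw [conjSubgroup_map, ← Subgroup.map_inf _ _ _ e.injective,
      hmal g fun h => hg ⟨g, h, rfl⟩, Subgroup.map_bot]
  · intro i g
    obtain ⟨g, rfl⟩ := e.surjective g
    rw [← hmap i, conjSubgroup_map, ← Subgroup.map_inf _ _ _ e.injective, hav, Subgroup.map_bot]
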